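/- Let $n\ge 0$ and let $k\ge 1$ be integers. A function $R(z,\bar w)$ on $\mathbb C^n\times\mathbb C^n$, holomorphic in $(z,\bar w)$ (that is, $R(z,\zeta)$ is entire on $\mathbb C^n\times\mathbb C^n$), is called Hermitian symmetric if $R(z,\bar w)=\overline{R(w,\bar z)}$ for all $z,w\in\mathbb C^n$. For each positive integer $N$, let $\mathcal P_N$ be the set of Hermitian symmetric functions $R$ such that $$\sum_{i,j=1}^N R(z_i,\bar z_j)\,a_i\bar a_j\ge 0\qquad\text{for all } z_1,\dots,z_N\in\mathbb C^n,\ a\in\mathbb C^N,$$ and let $\mathcal P_\infty=\bigcap_{N\ge 1}\mathcal P_N$. For a set $S$ of Hermitian symmetric functions, the stability index $I(S)$ is the smallest positive integer $m$ with $S\cap\mathcal P_\infty=S\cap\mathcal P_m$, and $I(S)=\infty$ if there is no such $m$; $S$ is called stable if $I(S)<\infty$. Let $R(z,\bar z)=\sum_{a,b}c_{ab}z^a\bar z^b$ be the Taylor expansion at the origin of a Hermitian symmetric function $R$, and let $N_+(R)\in\{0,1,2,\dots,\infty\}$ be the number of positive eigenvalues, counted with multiplicity, of the (perhaps infinite)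 Hermitian matrix $(c_{ab})$, acting on $\ell^2$ of the set of multi-indices. Let $S_k$ be the set of Hermitian symmetric functions $R$ on $\mathbb C^n$ with $N_+(R)\le k$. Then $$S_k\cap\mathcal P_k=S_k\cap\mathcal P_\infty;$$ consequently $I(S_k)\le k$, and $S_k$ is stable. -/

import Mathlib

open scoped ComplexOrder

namespace HermitianSymmetric

/-- A function `R` on `ℂⁿ × (ℂⁿ)'` is written in the coordinates `(z, ζ)`, `ζ = conj w`; so the value
`R(z, conj w)` is `R (z, star w)`, where `star` is coordinatewise complex conjugation.  `R` is
Hermitian symmetric if it is (jointly) holomorphic and `R(z, conj w) = conj (R(w, conj z))`. -/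
structure IsHermitianSymmetric {n : ℕ} (R : (Fin n → ℂ) × (Fin n → ℂ) → ℂ) : Prop where
  holomorphic : Differentiable ℂ R
  symm : ∀ z w : Fin n → ℂ, R (z, star w) = star (R (w, star z))

/-- The positivity class `𝒫_N`: Hermitian symmetric functions with
`∑ R(z_i, conj z_j) a_i conj(a_j) ≥ 0` for all `N` points of `ℂⁿ` and all `a ∈ ℂᴺ`.  The order on `ℂ`
is the usual partial order: `0 ≤ x` means that `x` is real and nonnegative.  For `N = 0` this is the
set of all Hermitian symmetric functions. -/
def posClass (n N : ℕ) : Set ((Fin n → ℂ) × (Fin n → ℂ) → ℂ) :=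
  {R | IsHermitianSymmetric R ∧
    ∀ (z : Fin N → Fin n → ℂ) (a : Fin N → ℂ),
      0 ≤ ∑ i, ∑ j, R (z i, star (z j)) * a i * star (a j)}

/-- `𝒫_∞`, the intersection of the `𝒫_N` over all positive integers `N`. -/
def posClassInf (n : ℕ) : Set ((Fin n → ℂ) × (Fin n → ℂ) → ℂ) :=
  ⋂ (N : ℕ) (_ : 1 ≤ N), posClass n N

/-- The stability index of `S`: the smallest positive integer `k` with `S ∩ 𝒫_∞ = S ∩ 𝒫_k`, and
`∞` if there is none. -/
noncomputable def stabilityIndex {n : ℕ} (S : Set ((Fin n → ℂ) × (Fin n → ℂ) → ℂ)) : ℕ∞ :=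
  sInf {m : ℕ∞ | ∃ k : ℕ, 1 ≤ k ∧ m = k ∧ S ∩ posClassInf n = S ∩ posClass n k}

/-- `S` is stable if its stability index is finite. -/
def IsStable {n : ℕ} (S : Set ((Fin n → ℂ) × (Fin n → ℂ) → ℂ)) : Prop :=
  stabilityIndex S ≠ ⊤

/-- The iterated directional derivative `∂_{v 0}^{a 0} ⋯ ∂_{v (n-1)}^{a (n-1)} F`. -/
noncomputable def multiDeriv {E : Type*} [NormedAddCommGroup E] [NormedSpace ℂ E] {n : ℕ}
    (v : Fin n → E) (a : Fin n → ℕ) (F : E → ℂ) : E → ℂ :=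
  (List.finRange n).foldr (fun i G => (fun H x => lineDeriv ℂ H x (v i))^[a i] G) F

/-- The matrix of Taylor coefficients of `R` at the origin,
`c_{ab} = (∂_z^a ∂_ζ^b R)(0, 0) / (a! b!)`, where `R(z, ζ) = ∑ c_{ab} z^a ζ^b`, indexed by pairs of
multi-indices. -/
noncomputable def taylorMatrix {n : ℕ} (R : (Fin n → ℂ) × (Fin n → ℂ) → ℂ) :
    Matrix (Fin n → ℕ) (Fin n → ℕ) ℂ := fun a b =>
  multiDeriv (fun i => (Pi.single i 1, 0)) a (multiDeriv (fun i => (0, Pi.single i 1)) b R) 0 /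
    ((∏ i, (a i).factorial : ℕ) * (∏ i, (b i).factorial : ℕ))

/-- The eigenspace, in `ℓ²`, of a (perhaps infinite) matrix `c` for `μ`: the square-summable `v` with
`∑_b c_{ab} v_b = μ v_a` for every `a`. -/
def matrixEigenspace {ι : Type*} (c : Matrix ι ι ℂ) (μ : ℂ) :
    Submodule ℂ (lp (fun _ : ι => ℂ) 2) where
  carrier := {v | ∀ a, HasSum (fun b => c a b * v b) (μ * v a)}
  zero_mem' := fun a => by simp
  add_mem' := fun {v w} hv hw a => by
    simpa [mul_add] using (hv a).add (hw a)
  smul_mem' := fun t v hv a => by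
    simpa [mul_left_comm] using (hv a).mul_left t

/-- `N_+(R)`: the number of positive eigenvalues, counted with multiplicity, of the matrix of Taylor
coefficients of `R`, that is, the dimension (perhaps `∞`) of the sum of its eigenspaces for positive
eigenvalues. -/
noncomputable def numPosEigenvalues {n : ℕ} (R : (Fin n → ℂ) × (Fin n → ℂ) → ℂ) : ℕ∞ :=
  Cardinal.toENat (Module.rank ℂ
    (⨆ (μ : ℝ) (_ : 0 < μ), matrixEigenspace (taylorMatrix R) (μ : ℂ) :
      Submodule ℂ (lp (fun _ : Fin n → ℕ => ℂ) 2)))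

/-- `S_k`: the Hermitian symmetric functions on `ℂⁿ` whose matrix of Taylor coefficients has at most
`k` positive eigenvalues. -/
def atMostPosEigenvalues (n k : ℕ) : Set ((Fin n → ℂ) × (Fin n → ℂ) → ℂ) :=
  {R | IsHermitianSymmetric R ∧ numPosEigenvalues R ≤ k}

end HermitianSymmetric

/-! The Taylor matrix `c` of a Hermitian symmetric function `R` is Hermitian, by uniqueness of power
series expansions (`taylorMatrix_star`), and its entries decay faster than any geometric sequence, by
Cauchy's estimates (`exists_norm_taylorMatrix_le`). Hence it acts on `ℓ²` as a compact self-adjoint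
operator, which is negative semidefinite on the orthogonal complement of the sum `W` of its
eigenspaces for positive eigenvalues (`re_inner_nonpos_of_mem_orthogonal`). If `W` has dimension
`m ≤ k`, this yields a decomposition
`R(z, conj w) = f(z) ⬝ᵥ A *ᵥ conj (f(w)) - ⟪g(w), g(z)⟫`
with an entire map `f` into `ℂᵐ` and a map `g` into a Hilbert space
(`exists_finiteRank_sub_posSemidef`, `exists_featureMap`). The conjugate monomials representing point
evaluations need not be square-summable, so positivity of the second kernel is obtained as a limit
over truncations.

Choose points `z_1, …, z_r`, `r ≤ m`, at which the values of `f` form a basis of the span of all its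
values, and write `f(w) = ∑ c_l(w) f(z_l)` with entire coefficients. Replacing `z_j` by `w`, positivity
of `R` on `r ≤ k` points shows that the defect `g(w) - ∑ c_l(w) g(z_l)` is bounded by a constant times
`c_j(w)`. Its inner products with the values of `g` are entire along lines and vanish at `z_j`, where
`c_j = 1`, so Liouville's theorem for the quotient by `c_j` forces the defect to be zero
(`eq_zero_of_norm_le_mul_norm`, `eq_sum_smul_of_nonneg`). Therefore every form
`∑ R(p_i, conj p_j) a_i conj a_j` equals such a form at the points `z_l`, which is nonnegative because
there are at most `k` of them. -/

/-! ### Partial derivatives of entire functions of several variables -/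

namespace HermitianSymmetric

section Entire

variable {E : Type*} [NormedAddCommGroup E] [NormedSpace ℂ E]

theorem differentiable_comp_line {F : E → ℂ} (hF : Differentiable ℂ F) (x v : E) :
    Differentiable ℂ fun s : ℂ => F (x + s • v) := by
  fun_prop

/-- Cauchy's estimate for the full derivative. -/
theorem norm_fderiv_le_of_forall_closedBall {F : E → ℂ} (hF : Differentiable ℂ F) {x : E} {C : ℝ}
    (hC : ∀ y ∈ Metric.closedBall x 1, ‖F y‖ ≤ C) : ‖fderiv ℂ F x‖ ≤ C := by
  have hC0 : 0 ≤ C := (norm_nonneg _).trans (hC x (by simp))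
  refine ContinuousLinearMap.opNorm_le_bound _ hC0 fun u => ?_
  rcases eq_or_ne u 0 with rfl | hu
  · simp
  have hu' : 0 < ‖u‖ := norm_pos_iff.2 hu
  rw [← (hF x).lineDeriv_eq_fderiv, lineDeriv]
  have := Complex.norm_deriv_le_of_forall_mem_sphere_norm_le (c := 0) (R := ‖u‖⁻¹) (C := C)
    (f := fun s : ℂ => F (x + s • u)) (by positivity)
    (differentiable_comp_line hF x u).diffContOnCl fun s hs => hC _ ?_
  · simpa [div_inv_eq_mul] using this
  · have : ‖s‖ = ‖u‖⁻¹ := by simpa using hs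
    simp [norm_smul, this, hu'.ne']

/-- Directional derivatives of an entire function on a finite-dimensional space are entire: they are
given by Cauchy's integral over a circle, which can be differentiated under the integral sign. -/
theorem differentiable_lineDeriv [FiniteDimensional ℂ E] {F : E → ℂ} (hF : Differentiable ℂ F)
    (v : E) : Differentiable ℂ fun x => lineDeriv ℂ F x v := by
  intro x₀
  have : ProperSpace E := FiniteDimensional.proper ℂ E
  let _ : MeasurableSpace E := borel E
  have : BorelSpace E := ⟨rfl⟩
  obtain ⟨C, hC⟩ := (isCompact_closedBall x₀ (‖v‖ + 2)).exists_bound_of_continuousOn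
    hF.continuous.continuousOn
  have hrep : (fun x => lineDeriv ℂ F x v) = fun x => (2 * Real.pi * Complex.I : ℂ)⁻¹ •
      ∫ θ in (0 : ℝ)..2 * Real.pi, (deriv (circleMap 0 1) θ * ((circleMap 0 1 θ - 0) ^ 2)⁻¹) *
        F (x + circleMap 0 1 θ • v) := by
    ext x
    rw [lineDeriv, ← Complex.cderiv_eq_deriv isOpen_univ
      (differentiable_comp_line hF x v).differentiableOn one_pos (Set.subset_univ _),
      Complex.cderiv, circleIntegral]
    simp only [smul_eq_mul, mul_assoc]
  rw [hrep]
  have hker : Continuous fun θ : ℝ =>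
      deriv (circleMap 0 1) θ * ((circleMap 0 1 θ - 0) ^ 2)⁻¹ := by
    refine Continuous.mul ?_ (Continuous.inv₀ (by fun_prop) fun θ => ?_)
    · have : deriv (circleMap 0 1) = fun θ => circleMap 0 1 θ * Complex.I := by ext; simp
      rw [this]
      fun_prop
    · simp
  have hnorm : ∀ θ : ℝ, ‖deriv (circleMap 0 1) θ * ((circleMap 0 1 θ - 0) ^ 2)⁻¹‖ = 1 := by
    intro θ; simp
  refine DifferentiableAt.fun_const_smul (HasFDerivAt.differentiableAt
    (intervalIntegral.hasFDerivAt_integral_of_dominated_of_fderiv_le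
    (F' := fun x θ => (deriv (circleMap 0 1) θ * ((circleMap 0 1 θ - 0) ^ 2)⁻¹) •
      fderiv ℂ F (x + circleMap 0 1 θ • v)) (bound := fun _ => C)
    (Metric.ball_mem_nhds x₀ one_pos) ?_ ?_ ?_ ?_ ?_ ?_)) _
  · refine Filter.Eventually.of_forall fun x => Continuous.aestronglyMeasurable ?_
    exact hker.mul (hF.continuous.comp (by fun_prop))
  · exact (hker.mul (hF.continuous.comp (by fun_prop))).intervalIntegrable _ _
  · refine hker.aestronglyMeasurable.smul (Measurable.aestronglyMeasurable ?_)
    exact (measurable_fderiv ℂ F).comp (Continuous.measurable (by fun_prop))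
  · refine Filter.Eventually.of_forall fun θ _ x hx => ?_
    rw [norm_smul, hnorm, one_mul]
    refine norm_fderiv_le_of_forall_closedBall hF fun y hy => hC y ?_
    rw [Metric.mem_closedBall] at hy ⊢
    rw [Metric.mem_ball] at hx
    have h1 : dist (x + circleMap 0 1 θ • v) x ≤ ‖v‖ := by
      simp [norm_smul]
    linarith [dist_triangle4 y (x + circleMap 0 1 θ • v) x x₀]
  · exact intervalIntegrable_const
  · refine Filter.Eventually.of_forall fun θ _ x _ => ?_
    have := (hF (x + circleMap 0 1 θ • v)).hasFDerivAt.comp x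
      ((hasFDerivAt_id x).add_const (circleMap 0 1 θ • v))
    exact HasFDerivAt.const_mul this _

theorem differentiable_lineDeriv_iterate [FiniteDimensional ℂ E] {F : E → ℂ}
    (hF : Differentiable ℂ F) (v : E) (k : ℕ) :
    Differentiable ℂ ((fun (H : E → ℂ) x => lineDeriv ℂ H x v)^[k] F) := by
  induction k with
  | zero => exact hF
  | succ k ih =>
    rw [Function.iterate_succ_apply']
    exact differentiable_lineDeriv ih v

theorem lineDeriv_iterate_eq_iteratedDeriv (F : E → ℂ) (x v : E) (k : ℕ) (s : ℂ) :
    (fun (H : E → ℂ) x => lineDeriv ℂ H x v)^[k] F (x + s • v) =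
      iteratedDeriv k (fun s : ℂ => F (x + s • v)) s := by
  induction k generalizing s with
  | zero => simp
  | succ k ih =>
    rw [Function.iterate_succ_apply', iteratedDeriv_succ, ← funext ih, lineDeriv]
    simp only [add_assoc, ← add_smul]
    rw [deriv_comp_const_add (f := fun t : ℂ =>
      (fun (H : E → ℂ) x => lineDeriv ℂ H x v)^[k] F (x + t • v)), add_zero]

theorem multiDeriv_zero (v : Fin 0 → E) (a : Fin 0 → ℕ) (F : E → ℂ) : multiDeriv v a F = F := by
  simp [multiDeriv]

theorem multiDeriv_succ {n : ℕ} (v : Fin (n + 1) → E) (a : Fin (n + 1) → ℕ) (F : E → ℂ) :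
    multiDeriv v a F = (fun (H : E → ℂ) x => lineDeriv ℂ H x (v 0))^[a 0]
      (multiDeriv (fun i => v i.succ) (fun i => a i.succ) F) := by
  simp [multiDeriv, List.finRange_succ, List.foldr_map]

variable [FiniteDimensional ℂ E]

theorem differentiable_multiDeriv {n : ℕ} (v : Fin n → E) (a : Fin n → ℕ) {F : E → ℂ}
    (hF : Differentiable ℂ F) : Differentiable ℂ (multiDeriv v a F) := by
  induction n with
  | zero => rwa [multiDeriv_zero]
  | succ n ih =>
    rw [multiDeriv_succ]
    exact differentiable_lineDeriv_iterate (ih _ _) _ _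

/-- Cauchy's estimate on the polydisc of radius `r` spanned by the directions `v`. -/
theorem norm_multiDeriv_le {n : ℕ} (v : Fin n → E) (a : Fin n → ℕ) {F : E → ℂ}
    (hF : Differentiable ℂ F) (x : E) {r C : ℝ} (hr : 0 < r)
    (hC : ∀ t : Fin n → ℂ, (∀ i, ‖t i‖ ≤ r) → ‖F (x + ∑ i, t i • v i)‖ ≤ C) :
    ‖multiDeriv v a F x‖ ≤ (∏ i, (a i).factorial : ℕ) * C * r⁻¹ ^ ∑ i, a i := by
  induction n generalizing x with
  | zero => simpa [multiDeriv_zero] using hC 0 (by simp)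
  | succ n ih =>
    have key := Complex.norm_iteratedDeriv_le_of_forall_mem_sphere_norm_le (c := 0) (R := r)
      (C := (∏ i : Fin n, (a i.succ).factorial : ℕ) * C * r⁻¹ ^ ∑ i : Fin n, a i.succ)
      (f := fun s : ℂ => multiDeriv (fun i => v i.succ) (fun i => a i.succ) F (x + s • v 0))
      (a 0) hr (differentiable_comp_line (differentiable_multiDeriv _ _ hF) _ _).diffContOnCl
      fun s hs => ih _ _ _ fun t ht => ?_
    · rw [← lineDeriv_iterate_eq_iteratedDeriv] at key
      rw [multiDeriv_succ]
      simp only [zero_smul, add_zero] at key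
      refine key.trans_eq ?_
      rw [Fin.prod_univ_succ, Fin.sum_univ_succ, pow_add, inv_pow]
      push_cast
      ring
    · have := hC (Fin.cons s t) (Fin.cases (by simpa using (mem_sphere_zero_iff_norm.1 hs).le)
        (by simpa using ht))
      simpa [Fin.sum_univ_succ, add_assoc] using this

end Entire

/-! ### Power series in several variables -/

theorem summable_prod_pow {n : ℕ} {q : Fin n → ℝ} (h0 : ∀ i, 0 ≤ q i) (h1 : ∀ i, q i < 1) :
    Summable fun a : Fin n → ℕ => ∏ i, q i ^ a i := by
  induction n with
  | zero => exact .of_finite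
  | succ n ih =>
    rw [← (Fin.consEquiv fun _ : Fin (n + 1) => ℕ).summable_iff]
    have := (summable_geometric_of_lt_one (h0 0) (h1 0)).mul_of_nonneg
      (ih (q := fun i => q i.succ) (fun i => h0 _) fun i => h1 _)
      (fun k => pow_nonneg (h0 0) k) fun a => Finset.prod_nonneg fun i _ => pow_nonneg (h0 _) _
    simpa [Function.comp_def, Fin.prod_univ_succ, Fin.consEquiv] using this

theorem summable_pow_sum {n : ℕ} {q : ℝ} (h0 : 0 ≤ q) (h1 : q < 1) :
    Summable fun a : Fin n → ℕ => q ^ ∑ i, a i := by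
  simpa [Finset.prod_pow_eq_pow_sum] using
    summable_prod_pow (n := n) (q := fun _ => q) (fun _ => h0) fun _ => h1

theorem norm_monomial_le {n : ℕ} (t : Fin n → ℂ) (a : Fin n → ℕ) :
    ‖∏ i, t i ^ a i‖ ≤ ‖t‖ ^ ∑ i, a i := by
  rw [norm_prod, ← Finset.prod_pow_eq_pow_sum]
  refine Finset.prod_le_prod (fun _ _ => norm_nonneg _) fun i _ => ?_
  rw [norm_pow]
  gcongr
  exact norm_le_pi_norm t i

/-- An entire function is the sum of its Taylor series in the directions `v`. -/
theorem hasSum_multiDeriv {E : Type*} [NormedAddCommGroup E] [NormedSpace ℂ E]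
    [FiniteDimensional ℂ E] {n : ℕ} (v : Fin n → E) {F : E → ℂ}
    (hF : Differentiable ℂ F) (x : E) (t : Fin n → ℂ) :
    HasSum (fun a : Fin n → ℕ =>
      multiDeriv v a F x / (∏ i, (a i).factorial : ℕ) * ∏ i, t i ^ a i)
      (F (x + ∑ i, t i • v i)) := by
  induction n generalizing x with
  | zero => simp [multiDeriv_zero]
  | succ n ih =>
    -- Absolute summability comes from Cauchy's estimate on a polydisc of radius `r > ‖t‖`.
    have hsum : Summable fun a : Fin (n + 1) → ℕ =>
        multiDeriv v a F x / (∏ i, (a i).factorial : ℕ) * ∏ i, t i ^ a i := by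
      obtain ⟨C, hC⟩ := (isCompact_closedBall (0 : Fin (n + 1) → ℂ)
        (‖t‖ + 1)).exists_bound_of_continuousOn
        (f := fun s => F (x + ∑ i, s i • v i)) (hF.continuous.comp (by fun_prop)).continuousOn
      have hr : 0 < ‖t‖ + 1 := by positivity
      refine Summable.of_norm_bounded (g := fun a : Fin (n + 1) → ℕ =>
        C * (‖t‖ / (‖t‖ + 1)) ^ ∑ i, a i) ((summable_pow_sum (by positivity)
          ((div_lt_one hr).2 (by linarith))).mul_left C) fun a => ?_
      have h1 := norm_multiDeriv_le v a hF x hr (C := C) fun s hs => hC s (by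
        simpa using (pi_norm_le_iff_of_nonneg hr.le).2 hs)
      have hfac : (0 : ℝ) < (∏ i, (a i).factorial : ℕ) := by
        exact_mod_cast Finset.prod_pos fun i _ => Nat.factorial_pos _
      have h2 : ‖multiDeriv v a F x‖ / (∏ i, (a i).factorial : ℕ) ≤
          C * (‖t‖ + 1)⁻¹ ^ ∑ i, a i := by
        rwa [div_le_iff₀' hfac, ← mul_assoc]
      rw [norm_mul, norm_div, Complex.norm_natCast, div_pow, div_eq_mul_inv _ ((‖t‖ + 1) ^ _),
        ← inv_pow, ← mul_assoc, mul_right_comm]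
      refine mul_le_mul h2 (norm_monomial_le t a) (norm_nonneg _) ((div_nonneg (norm_nonneg _)
        hfac.le).trans h2)
    let e : (Fin n → ℕ) × ℕ ≃ (Fin (n + 1) → ℕ) :=
      (Equiv.prodComm _ _).trans (Fin.consEquiv fun _ : Fin (n + 1) => ℕ)
    have hfib : HasSum (fun a' : Fin n → ℕ => multiDeriv (fun i => v i.succ) a' F (x + t 0 • v 0) /
        (∏ i, (a' i).factorial : ℕ) * ∏ i, t i.succ ^ a' i) (F (x + ∑ i, t i • v i)) := by
      have := ih (fun i => v i.succ) (x + t 0 • v 0) (fun i => t i.succ)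
      rwa [add_assoc, ← Fin.sum_univ_succ (fun i => t i • v i)] at this
    rw [← e.hasSum_iff]
    have hs := (e.summable_iff.2 hsum).hasSum
    have huniq := hs.prod_fiberwise (g := fun a' : Fin n → ℕ =>
      multiDeriv (fun i => v i.succ) a' F (x + t 0 • v 0) /
        (∏ i, (a' i).factorial : ℕ) * ∏ i, t i.succ ^ a' i) fun a' => ?_
    · rwa [← huniq.unique hfib]
    · have := (Complex.hasSum_taylorSeries_of_entire (differentiable_comp_line
        (differentiable_multiDeriv (fun i => v i.succ) a' hF) x (v 0)) 0 (t 0)).mul_right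
        ((∏ i, (a' i).factorial : ℕ) : ℂ)⁻¹ |>.mul_right (∏ i, t i.succ ^ a' i)
      simp only [← lineDeriv_iterate_eq_iteratedDeriv] at this
      rw [← div_eq_mul_inv] at this
      refine Eq.subst (motive := fun f => HasSum f _) (funext fun k => Eq.symm ?_) this
      simp only [Function.comp_apply, e, Equiv.trans_apply, Equiv.prodComm_apply, Prod.swap_prod_mk,
        Fin.consEquiv, Equiv.coe_fn_mk, multiDeriv_succ, Fin.prod_univ_succ, Fin.cons_zero,
        Fin.cons_succ, zero_smul, add_zero, sub_zero, smul_eq_mul]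
      push_cast
      field_simp

/-- The coefficients of an everywhere convergent power series in several variables are determined
by its sum. -/
theorem eq_zero_of_hasSum_monomial {n : ℕ} {e : (Fin n → ℕ) → ℂ}
    (h : ∀ t : Fin n → ℂ, HasSum (fun a => e a * ∏ i, t i ^ a i) 0) : e = 0 := by
  have one : ∀ d : ℕ → ℂ, (∀ t : ℂ, HasSum (fun k => d k * t ^ k) 0) → d = 0 := by
    intro d hd
    have hp : HasFPowerSeriesOnBall (0 : ℂ → ℂ) (FormalMultilinearSeries.ofScalars ℂ d) 0 1 := by
      refine ⟨?_, one_pos, fun {y} _ => ?_⟩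
      · refine FormalMultilinearSeries.le_radius_of_summable_norm (r := 1) _ ?_
        simpa using (hd 1).summable.norm
      · simpa [FormalMultilinearSeries.ofScalars_apply_eq, mul_comm] using hd y
    ext k
    have := congrArg (fun p => p.coeff k) hp.hasFPowerSeriesAt.eq_zero
    rw [FormalMultilinearSeries.coeff_ofScalars] at this
    exact this
  induction n with
  | zero =>
    ext a
    have := (h 0).unique (hasSum_fintype _)
    rw [Fintype.sum_subsingleton _ a] at this
    simpa using this.symm
  | succ n ih =>
    have hs : ∀ (t' : Fin n → ℂ) (t₀ : ℂ), HasSum (fun p : ℕ × (Fin n → ℕ) =>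
        e (Fin.cons p.1 p.2) * (∏ i, t' i ^ p.2 i) * t₀ ^ p.1) 0 := by
      intro t' t₀
      convert (Fin.consEquiv fun _ : Fin (n + 1) => ℕ).hasSum_iff.2
        (h (Fin.cons t₀ t')) using 2 with p
      simp only [Function.comp_apply, Fin.consEquiv, Equiv.coe_fn_mk, Fin.prod_univ_succ,
        Fin.cons_zero, Fin.cons_succ]
      ring
    have hsf : ∀ (t' : Fin n → ℂ) (k : ℕ),
        Summable fun a' : Fin n → ℕ => e (Fin.cons k a') * ∏ i, t' i ^ a' i := by
      intro t' k
      have := (hs t' 1).summable.prod_factor k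
      simpa only [one_pow, mul_one] using this
    have key : ∀ (t' : Fin n → ℂ) (k : ℕ),
        HasSum (fun a' : Fin n → ℕ => e (Fin.cons k a') * ∏ i, t' i ^ a' i) 0 := by
      intro t' k
      have hrow : ∀ t₀ : ℂ, HasSum (fun k =>
          (∑' a' : Fin n → ℕ, e (Fin.cons k a') * ∏ i, t' i ^ a' i) * t₀ ^ k) 0 := fun t₀ =>
        (hs t' t₀).prod_fiberwise fun k => (hsf t' k).hasSum.mul_right (t₀ ^ k)
      have := congrFun (one _ hrow) k
      rw [Pi.zero_apply] at this
      rw [← this]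
      exact (hsf t' k).hasSum
    ext a
    have := congrFun (ih fun t' => key t' (a 0)) fun i => a i.succ
    rwa [show (Fin.cons (a 0) fun i : Fin n => a i.succ : Fin (n + 1) → ℕ) = a from
      Fin.cons_self_tail a] at this

/-! ### The Taylor matrix of an entire function -/

section TaylorMatrix

variable {n : ℕ} {R : (Fin n → ℂ) × (Fin n → ℂ) → ℂ}

theorem sum_smul_single_fst (t : Fin n → ℂ) :
    ∑ i, t i • ((Pi.single i 1, 0) : (Fin n → ℂ) × (Fin n → ℂ)) = (t, 0) := by
  ext i
  · simp [Prod.fst_sum, Finset.sum_apply, Pi.single_apply]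
  · simp [Prod.snd_sum]

theorem sum_smul_single_snd (t : Fin n → ℂ) :
    ∑ i, t i • ((0, Pi.single i 1) : (Fin n → ℂ) × (Fin n → ℂ)) = (0, t) := by
  ext i
  · simp [Prod.fst_sum]
  · simp [Prod.snd_sum, Finset.sum_apply, Pi.single_apply]

/-- The Taylor coefficients of an entire function decay faster than any geometric sequence. -/
theorem exists_norm_taylorMatrix_le (hR : Differentiable ℂ R) {r : ℝ} (hr : 0 < r) :
    ∃ M, 0 ≤ M ∧ ∀ a b, ‖taylorMatrix R a b‖ ≤ M * (r⁻¹ ^ ∑ i, a i) * (r⁻¹ ^ ∑ i, b i) := by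
  obtain ⟨C, hC⟩ := (isCompact_closedBall (0 : (Fin n → ℂ) × (Fin n → ℂ))
    r).exists_bound_of_continuousOn hR.continuous.continuousOn
  have hC0 : 0 ≤ C := (norm_nonneg _).trans (hC 0 (by simpa using hr.le))
  refine ⟨C, hC0, fun a b => ?_⟩
  have h1 := norm_multiDeriv_le (fun i => ((Pi.single i 1, 0) : (Fin n → ℂ) × (Fin n → ℂ))) a
    (differentiable_multiDeriv (fun i => ((0, Pi.single i 1) : (Fin n → ℂ) × (Fin n → ℂ))) b hR)
    0 hr fun t ht => norm_multiDeriv_le _ b hR _ hr fun s hs => hC _ ?_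
  · have ha : (0 : ℝ) < (∏ i, (a i).factorial : ℕ) := by
      exact_mod_cast Finset.prod_pos fun i _ => Nat.factorial_pos _
    have hb : (0 : ℝ) < (∏ i, (b i).factorial : ℕ) := by
      exact_mod_cast Finset.prod_pos fun i _ => Nat.factorial_pos _
    rw [taylorMatrix, norm_div, norm_mul, Complex.norm_natCast, Complex.norm_natCast,
      div_le_iff₀ (mul_pos ha hb)]
    exact h1.trans_eq (by ring)
  · rw [sum_smul_single_fst, sum_smul_single_snd, mem_closedBall_zero_iff]
    simpa [Prod.norm_def] using
      ⟨(pi_norm_le_iff_of_nonneg hr.le).2 ht, (pi_norm_le_iff_of_nonneg hr.le).2 hs⟩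

theorem summable_norm_taylorMatrix (hR : Differentiable ℂ R) :
    Summable fun p : (Fin n → ℕ) × (Fin n → ℕ) => ‖taylorMatrix R p.1 p.2‖ := by
  obtain ⟨M, -, hM⟩ := exists_norm_taylorMatrix_le hR two_pos
  have hs : Summable fun a : Fin n → ℕ => ((2 : ℝ)⁻¹) ^ ∑ i, a i :=
    summable_pow_sum (by norm_num) (by norm_num)
  refine Summable.of_nonneg_of_le (fun _ => norm_nonneg _) (fun p => ?_)
    ((hs.mul_of_nonneg hs (fun _ => by positivity) fun _ => by positivity).mul_left M)
  simpa only [mul_assoc] using hM p.1 p.2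

/-- An entire function is the sum of the power series whose coefficients form its Taylor matrix. -/
theorem hasSum_taylorMatrix (hR : Differentiable ℂ R) (z ζ : Fin n → ℂ) :
    HasSum (fun p : (Fin n → ℕ) × (Fin n → ℕ) =>
      taylorMatrix R p.1 p.2 * ((∏ i, z i ^ p.1 i) * ∏ i, ζ i ^ p.2 i)) (R (z, ζ)) := by
  have hsum : Summable (fun p : (Fin n → ℕ) × (Fin n → ℕ) =>
      taylorMatrix R p.1 p.2 * ((∏ i, z i ^ p.1 i) * ∏ i, ζ i ^ p.2 i)) := by
    obtain ⟨r, hr⟩ : ∃ r, r = ‖z‖ + ‖ζ‖ + 1 := ⟨_, rfl⟩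
    have hr0 : 0 < r := by rw [hr]; positivity
    obtain ⟨M, hM0, hM⟩ := exists_norm_taylorMatrix_le hR hr0
    have hs : ∀ t : Fin n → ℂ, ‖t‖ < r →
        Summable fun a : Fin n → ℕ => r⁻¹ ^ (∑ i, a i) * ‖t‖ ^ ∑ i, a i := fun t ht => by
      simp only [← mul_pow]
      exact summable_pow_sum (by positivity) (by rwa [inv_mul_lt_one₀ hr0])
    refine Summable.of_norm_bounded
      (((hs z (by rw [hr]; linarith [norm_nonneg ζ])).mul_of_nonneg
        (hs ζ (by rw [hr]; linarith [norm_nonneg z])) (fun _ => by positivity)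
        fun _ => by positivity).mul_left M) fun p => ?_
    rw [norm_mul, norm_mul]
    calc _ ≤ (M * (r⁻¹ ^ ∑ i, p.1 i) * (r⁻¹ ^ ∑ i, p.2 i)) *
        (‖z‖ ^ (∑ i, p.1 i) * ‖ζ‖ ^ ∑ i, p.2 i) := by
          gcongr
          · exact hM _ _
          · exact norm_monomial_le z p.1
          · exact norm_monomial_le ζ p.2
      _ = _ := by ring
  have hout := hasSum_multiDeriv (fun i => ((0, Pi.single i 1) : (Fin n → ℂ) × (Fin n → ℂ))) hR
    (z, 0) ζ
  rw [sum_smul_single_snd, Prod.mk_add_mk, add_zero, zero_add] at hout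
  have hs := ((Equiv.prodComm _ _).summable_iff.2 hsum).hasSum
  have hin := hs.prod_fiberwise (g := fun b =>
    multiDeriv (fun i => ((0, Pi.single i 1) : (Fin n → ℂ) × (Fin n → ℂ))) b R (z, 0) /
      (∏ i, (b i).factorial : ℕ) * ∏ i, ζ i ^ b i) fun b => ?_
  · rw [hout.unique hin]
    exact (Equiv.prodComm _ _).hasSum_iff.1 hs
  · have := hasSum_multiDeriv (fun i => ((Pi.single i 1, 0) : (Fin n → ℂ) × (Fin n → ℂ)))
      (differentiable_multiDeriv (fun i => ((0, Pi.single i 1) : (Fin n → ℂ) × (Fin n → ℂ))) b hR)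
      0 z
    rw [sum_smul_single_fst, zero_add] at this
    refine Eq.subst (motive := fun f => HasSum f _) (funext fun a => Eq.symm ?_)
      ((this.div_const ((∏ i, (b i).factorial : ℕ) : ℂ)).mul_right (∏ i, ζ i ^ b i))
    simp only [Function.comp_apply, Equiv.prodComm_apply, Prod.swap_prod_mk, taylorMatrix]
    ring

/-- The Taylor matrix of a Hermitian symmetric function is Hermitian, by uniqueness of power series
expansions. -/
theorem taylorMatrix_star (hR : IsHermitianSymmetric R) (a b : Fin n → ℕ) :
    taylorMatrix R b a = star (taylorMatrix R a b) := by
  set e : (Fin n → ℕ) → (Fin n → ℕ) → ℂ := fun b a => taylorMatrix R b a - star (taylorMatrix R a b)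
  suffices e = 0 from sub_eq_zero.1 (congrFun (congrFun this b) a)
  have hsum : ∀ z ζ : Fin n → ℂ, HasSum (fun p : (Fin n → ℕ) × (Fin n → ℕ) =>
      e p.1 p.2 * ((∏ i, z i ^ p.1 i) * ∏ i, ζ i ^ p.2 i)) 0 := by
    intro z ζ
    have h1 := hasSum_taylorMatrix hR.holomorphic z ζ
    have h2 := (Equiv.prodComm _ _).hasSum_iff.2
      (hasSum_taylorMatrix hR.holomorphic (star ζ) (star z)).star
    rw [← hR.symm, star_star] at h2
    have := h1.sub h2
    rw [sub_self] at this
    refine Eq.subst (motive := fun f => HasSum f _) (funext fun a => Eq.symm ?_) this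
    simp [e, sub_mul, mul_comm]
  have hs : ∀ (ζ : Fin n → ℂ) a, Summable fun b => e a b * ∏ i, ζ i ^ b i := fun ζ a => by
    by_contra hns
    have := (hsum 1 ζ).summable.prod_factor a
    simp only [Pi.one_apply, one_pow, Finset.prod_const_one, one_mul] at this
    exact hns this
  have h1 : ∀ ζ : Fin n → ℂ, (fun a => ∑' b, e a b * ∏ i, ζ i ^ b i) = 0 := fun ζ =>
    eq_zero_of_hasSum_monomial fun z => (hsum z ζ).prod_fiberwise fun a => by
      refine Eq.subst (motive := fun f => HasSum f _) (funext fun b => ?_)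
        ((hs ζ a).hasSum.mul_right (∏ i, z i ^ a i))
      ring
  funext a
  refine eq_zero_of_hasSum_monomial fun ζ => ?_
  have := congrFun (h1 ζ) a
  rw [Pi.zero_apply] at this
  rw [← this]
  exact (hs ζ a).hasSum

end TaylorMatrix

/-! ### Absolutely summable matrices as compact operators on `ℓ²` -/

section MatrixOperator

variable {ι : Type*}

open scoped Classical in
/-- The standard unit vectors of `ℓ²`. -/
noncomputable def unitVec (a : ι) : lp (fun _ : ι => ℂ) 2 := lp.single 2 a 1

theorem inner_unitVec_left (a : ι) (v : lp (fun _ : ι => ℂ) 2) : inner ℂ (unitVec a) v = v a := by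
  classical
  simp [unitVec, lp.inner_single_left]

theorem unitVec_apply_self (a : ι) : unitVec a a = 1 := by
  simp [unitVec]

theorem unitVec_apply_of_ne {a b : ι} (h : b ≠ a) : unitVec a b = 0 := by
  simp [unitVec, h]

theorem norm_unitVec (a : ι) : ‖unitVec a‖ = 1 := by
  simp [unitVec, lp.norm_single]

/-- The operator on `ℓ²` with matrix `c`, defined as the sum of its matrix units; it is meaningful
when the entries of `c` are absolutely summable. -/
noncomputable def matrixOp (c : Matrix ι ι ℂ) :
    lp (fun _ : ι => ℂ) 2 →L[ℂ] lp (fun _ : ι => ℂ) 2 :=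
  ∑' p : ι × ι, c p.1 p.2 • InnerProductSpace.rankOne ℂ (unitVec p.1) (unitVec p.2)

variable {c : Matrix ι ι ℂ} (hc : Summable fun p : ι × ι => ‖c p.1 p.2‖)

include hc

theorem hasSum_matrixOp :
    HasSum (fun p : ι × ι => c p.1 p.2 • InnerProductSpace.rankOne ℂ (unitVec p.1) (unitVec p.2))
      (matrixOp c) := by
  refine (Summable.of_norm_bounded hc fun p => ?_).hasSum
  simp [norm_smul, norm_unitVec]

theorem isCompactOperator_matrixOp : IsCompactOperator (matrixOp c) := by
  refine isCompactOperator_of_tendsto (hasSum_matrixOp hc) (Filter.Eventually.of_forall fun s => ?_)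
  refine (compactOperator (RingHom.id ℂ) (lp (fun _ : ι => ℂ) 2) (lp (fun _ : ι => ℂ) 2)).sum_mem
    fun p _ => Submodule.smul_mem _ _ ?_
  have h : IsCompactOperator (ContinuousLinearMap.toSpanSingleton ℂ (unitVec p.1)) :=
    isCompactOperator_of_locallyCompactSpace_rng _
  exact h.comp_clm (innerSL ℂ (unitVec p.2))

theorem hasSum_inner_matrixOp (v w : lp (fun _ : ι => ℂ) 2) :
    HasSum (fun p : ι × ι => c p.1 p.2 * (star (w p.1) * v p.2)) (inner ℂ w (matrixOp c v)) := by
  have h := ((innerSL ℂ w).comp (ContinuousLinearMap.apply ℂ _ v)).hasSum (hasSum_matrixOp hc)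
  refine Eq.subst (motive := fun f => HasSum f _) (funext fun p => ?_) h
  have hw : inner ℂ w (unitVec p.1) = star (w p.1) := by
    rw [← inner_conj_symm, inner_unitVec_left]; rfl
  simp [inner_unitVec_left, hw, mul_comm]

theorem hasSum_matrixOp_apply (v : lp (fun _ : ι => ℂ) 2) (a : ι) :
    HasSum (fun b => c a b * v b) (matrixOp c v a) := by
  have h := hasSum_inner_matrixOp hc v (unitVec a)
  rw [inner_unitVec_left, ← (Prod.mk_right_injective a).hasSum_iff] at h
  · simpa [Function.comp_def, unitVec_apply_self] using h
  · rintro ⟨a', b⟩ hp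
    have : a' ≠ a := by rintro rfl; exact hp ⟨b, rfl⟩
    simp [unitVec_apply_of_ne this]

theorem matrixEigenspace_eq_eigenspace (μ : ℂ) :
    matrixEigenspace c μ = Module.End.eigenspace (matrixOp c : Module.End ℂ _) μ := by
  ext v
  rw [Module.End.mem_eigenspace_iff]
  constructor
  · intro hv
    ext a
    exact (hasSum_matrixOp_apply hc v a).unique (hv a)
  · intro hv a
    have := hasSum_matrixOp_apply hc v a
    rwa [show matrixOp c v = μ • v from hv] at this

theorem isSymmetric_matrixOp (hherm : ∀ a b, c b a = star (c a b)) :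
    (matrixOp c : Module.End ℂ (lp (fun _ : ι => ℂ) 2)).IsSymmetric := by
  intro v w
  have h1 := (Equiv.prodComm _ _).hasSum_iff.2 (hasSum_inner_matrixOp hc v w).star
  have h2 := hasSum_inner_matrixOp hc w v
  have h3 : star (inner ℂ w (matrixOp c v)) = inner ℂ (matrixOp c v) w := inner_conj_symm _ _
  rw [h3] at h1
  refine h1.unique (Eq.subst (motive := fun f => HasSum f _) (funext fun p => ?_) h2)
  simp [hherm p.1 p.2, mul_comm]

end MatrixOperator

/-! ### The negative part of a compact self-adjoint operator -/

/-- A compact self-adjoint operator is negative semidefinite on the orthogonal complement of its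
eigenspaces for positive eigenvalues. -/
theorem re_inner_nonpos_of_mem_orthogonal {H : Type*} [NormedAddCommGroup H]
    [InnerProductSpace ℂ H] [CompleteSpace H] {T : H →L[ℂ] H} (hT : IsCompactOperator T)
    (hs : (T : Module.End ℂ H).IsSymmetric) {x : H}
    (hx : x ∈ (⨆ (μ : ℝ) (_ : 0 < μ), Module.End.eigenspace (T : Module.End ℂ H) (μ : ℂ))ᗮ) :
    (inner ℂ x (T x)).re ≤ 0 := by
  set W := ⨆ (μ : ℝ) (_ : 0 < μ), Module.End.eigenspace (T : Module.End ℂ H) (μ : ℂ) with hW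
  set V := ⨆ μ : {μ : ℝ // μ ≤ 0}, Module.End.eigenspace (T : Module.End ℂ H) ((μ : ℝ) : ℂ) with hV
  have hfam := hs.orthogonalFamily_eigenspaces
  -- The quadratic form is nonpositive on `V`, by orthogonality of the eigenspaces.
  have hneg : ∀ y ∈ V, (inner ℂ y (T y)).re ≤ 0 := by
    intro y hy
    obtain ⟨f, hf, rfl⟩ := (Submodule.mem_iSup_iff_exists_finsupp _ _).1 hy
    have hTf : ∀ μ, T (f μ) = ((μ : ℝ) : ℂ) • f μ := fun μ =>
      Module.End.mem_eigenspace_iff.1 (hf μ)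
    rw [Finsupp.sum, map_sum, sum_inner, Complex.re_sum]
    refine Finset.sum_nonpos fun μ hμ => ?_
    rw [inner_sum, Finset.sum_eq_single_of_mem μ hμ]
    · rw [hTf, inner_smul_right, inner_self_eq_norm_sq_to_K]
      have : (((μ : ℝ) : ℂ) * ((‖f μ‖ : ℝ) : ℂ) ^ 2).re = μ * ‖f μ‖ ^ 2 := by
        rw [← Complex.ofReal_pow, ← Complex.ofReal_mul, Complex.ofReal_re]
      exact this.trans_le (mul_nonpos_of_nonpos_of_nonneg μ.2 (sq_nonneg _))
    · intro ν _ hne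
      rw [hTf, inner_smul_right]
      have : inner ℂ (f μ) (f ν) = 0 := hfam (i := ((μ : ℝ) : ℂ)) (j := ((ν : ℝ) : ℂ))
        (fun h => hne (Subtype.ext (Complex.ofReal_injective h)).symm) ⟨f μ, hf μ⟩ ⟨f ν, hf ν⟩
      rw [this, mul_zero]
  have hVW : V ⟂ W := by
    simp only [hV, hW, Submodule.isOrtho_iSup_left, Submodule.isOrtho_iSup_right]
    intro μ hμ ν
    rw [Submodule.isOrtho_iff_inner_eq]
    intro y hy u hu
    exact hfam (i := ((ν : ℝ) : ℂ)) (j := (μ : ℂ))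
      (fun h => (hμ.trans_le ((Complex.ofReal_injective h).symm.trans_le ν.2)).false)
      ⟨y, hy⟩ ⟨u, hu⟩
  have htop : Wᗮ ⊓ Vᗮ = ⊥ := by
    rw [Submodule.inf_orthogonal, eq_bot_iff,
      ← ContinuousLinearMap.orthogonalComplement_iSup_eigenspaces_eq_bot hT hs]
    refine Submodule.orthogonal_le (iSup_le fun μ => ?_)
    by_cases hμ : Module.End.HasEigenvalue (T : Module.End ℂ H) μ
    · obtain ⟨t, rfl⟩ : ∃ t : ℝ, (t : ℂ) = μ :=
        ⟨μ.re, Complex.conj_eq_iff_re.1 (hs.conj_eigenvalue_eq_self hμ)⟩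
      rcases lt_or_ge 0 t with ht | ht
      · exact le_sup_of_le_left (le_iSup₂_of_le t ht le_rfl)
      · exact le_sup_of_le_right (le_iSup_of_le (⟨t, ht⟩ : {μ : ℝ // μ ≤ 0}) le_rfl)
    · rw [Module.End.hasEigenvalue_iff, not_not] at hμ
      rw [hμ]; exact bot_le
  have hcl : x ∈ V.topologicalClosure := by
    have hVc : V.topologicalClosure ≤ Wᗮ :=
      V.topologicalClosure_minimal hVW (Submodule.isClosed_orthogonal _)
    have : CompleteSpace V.topologicalClosure := V.isClosed_topologicalClosure.completeSpace_coe
    have hp := V.topologicalClosure.starProjection_apply_mem x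
    have hz : x - V.topologicalClosure.starProjection x ∈ Wᗮ ⊓ Vᗮ := by
      refine ⟨Submodule.sub_mem _ hx (hVc hp), ?_⟩
      exact Submodule.orthogonal_le V.le_topologicalClosure
        (V.topologicalClosure.sub_starProjection_mem_orthogonal x)
    rw [htop, Submodule.mem_bot, sub_eq_zero] at hz
    rw [hz]; exact hp
  have hclosed : IsClosed {y : H | (inner ℂ y (T y)).re ≤ 0} :=
    isClosed_le (Complex.continuous_re.comp (continuous_id.inner T.continuous)) continuous_const
  exact (closure_minimal hneg hclosed : closure (V : Set H) ⊆ _) hcl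

/-! ### Entire functions dominated by an entire function -/

/-- An entire function bounded by a multiple of an entire function `γ` is a multiple of `γ`, by
Liouville's theorem applied to the quotient, whose singularities are removable. In particular it
vanishes identically if it vanishes at a point where `γ` does not. -/
theorem eq_zero_of_norm_le_mul_norm {φ γ : ℂ → ℂ} (hφ : Differentiable ℂ φ)
    (hγ : Differentiable ℂ γ) {C : ℝ} (h : ∀ t, ‖φ t‖ ≤ C * ‖γ t‖) {t₀ : ℂ} (h0 : φ t₀ = 0)
    (h1 : γ t₀ ≠ 0) (t : ℂ) : φ t = 0 := by
  have hC : 0 ≤ C := by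
    have := (norm_nonneg _).trans (h t₀)
    exact nonneg_of_mul_nonneg_left this (norm_pos_iff.2 h1)
  set q : ℂ → ℂ := fun t => φ t / γ t with hq
  have hqC : ∀ t, ‖q t‖ ≤ C := fun t => by
    rw [hq, norm_div]
    exact div_le_of_le_mul₀ (norm_nonneg _) hC (h t)
  have hqd : ∀ t, γ t ≠ 0 → DifferentiableAt ℂ q t := fun t ht => (hφ t).div (hγ t) ht
  have hne : ∀ t, ∀ᶠ s in nhdsWithin t {t}ᶜ, γ s ≠ 0 := by
    intro t
    rcases (hγ.analyticAt t).eventually_eq_zero_or_eventually_ne_zero with hz | hz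
    · exfalso
      have : γ = 0 := AnalyticOnNhd.eq_of_eventuallyEq (fun s _ => hγ.analyticAt s)
        (fun s _ => analyticAt_const) hz
      exact h1 (congrFun this t₀)
    · exact hz
  -- The extension of the quotient across the zeros of `γ`.
  set Q : ℂ → ℂ := fun t => (nhdsWithin t {t}ᶜ).limUnder q with hQ
  have hQq : ∀ t, γ t ≠ 0 → Q t = q t := fun t ht =>
    ((hqd t ht).continuousAt.tendsto.mono_left nhdsWithin_le_nhds).limUnder_eq
  have hQd : Differentiable ℂ Q := by
    intro t
    obtain ⟨s, hst, hs, hts⟩ := eventually_nhds_iff.1 (eventually_nhdsWithin_iff.1 (hne t))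
    have hd := Complex.differentiableOn_update_limUnder_of_bddAbove (f := q) (hs.mem_nhds hts)
      (fun u hu => (hqd u (hst u hu.1 hu.2)).differentiableWithinAt)
      ⟨C, by rintro _ ⟨u, -, rfl⟩; exact hqC u⟩
    refine (hd.differentiableAt (hs.mem_nhds hts)).congr_of_eventuallyEq ?_
    filter_upwards [hs.mem_nhds hts] with u hu
    rcases eq_or_ne u t with rfl | hut
    · simp [hQ]
    · rw [Function.update_of_ne hut, hQq u (hst u hu hut)]
  have hQC : ∀ t, ‖Q t‖ ≤ C := fun t => by
    refine le_of_tendsto ((hQd.continuous.norm.tendsto t).mono_left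
      (nhdsWithin_le_nhds (s := {t}ᶜ))) ?_
    filter_upwards [hne t] with s hs
    rw [hQq s hs]
    exact hqC s
  have hQ0 : Q t = 0 := by
    rw [hQd.apply_eq_apply_of_bounded
      (isBounded_iff_forall_norm_le.2 ⟨C, by rintro _ ⟨u, rfl⟩; exact hQC u⟩) t t₀, hQq t₀ h1]
    simp [hq, h0]
  by_cases ht : γ t = 0
  · simpa [ht] using h t
  · rw [hQq t ht, hq] at hQ0
    exact (div_eq_zero_iff.1 hQ0).resolve_right ht

/-! ### Positive kernels that agree with a finite-rank kernel up to a positive one -/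

/-- A positive semidefinite kernel is the Gram kernel of a map into a Hilbert space. -/
theorem exists_featureMap {X : Type} {D : X → X → ℂ} (hD : ∀ x y, D y x = star (D x y))
    (hpos : ∀ (s : Finset X) (a : X → ℂ), 0 ≤ ∑ x ∈ s, ∑ y ∈ s, D x y * a x * star (a y)) :
    ∃ (H : Type) (_ : NormedAddCommGroup H) (_ : InnerProductSpace ℂ H) (g : X → H),
      ∀ x y, inner ℂ (g y) (g x) = D x y := by
  set K : Matrix X X (ℂ →L[ℂ] ℂ) := fun x y => D y x • ContinuousLinearMap.id ℂ ℂ with hK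
  have hherm : K.IsHermitian := by
    ext x y
    rw [Matrix.conjTranspose_apply]
    refine ext_inner_left ℂ fun w => ?_
    rw [ContinuousLinearMap.star_eq_adjoint, ContinuousLinearMap.adjoint_inner_right]
    simp [hK, hD x y, mul_comm]
  have hfact : Fact K.PosSemidef := by
    have key := (RKHS.posSemidef_tfae (K := K)).out 0 2
    refine ⟨key.2 ⟨hherm, fun vv => ?_⟩⟩
    have h := hpos vv.support vv
    have h' := (Complex.nonneg_iff.1 h).1
    rw [← Complex.conj_re] at h'
    refine h'.trans_eq (congrArg Complex.re ?_)
    simp only [Finsupp.sum, map_sum]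
    refine Finset.sum_congr rfl fun x _ => Finset.sum_congr rfl fun y _ => ?_
    simp only [hK, smul_apply, ContinuousLinearMap.id_apply, smul_eq_mul,
      RCLike.inner_apply, map_mul, RCLike.star_def, Complex.conj_conj]
    ring
  refine ⟨RKHS.OfKernel K, inferInstance, inferInstance,
    fun x => RKHS.kerFun (RKHS.OfKernel K) x 1, fun x y => ?_⟩
  have := RKHS.kernel_inner (RKHS.OfKernel K) x y (1 : ℂ) (1 : ℂ)
  rw [RKHS.OfKernel.kernel_ofKernel] at this
  rw [← this]
  simp [hK, hD x y]

open Matrix in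
/-- The quadratic form of the kernel `f x ⬝ᵥ A *ᵥ star (f y) - ⟪g y, g x⟫` at a finite combination
of points depends only on the corresponding combinations of the values of `f` and `g`. -/
theorem sum_kernel_eq {X H ι : Type*} [NormedAddCommGroup H] [InnerProductSpace ℂ H] [Fintype ι]
    {m : ℕ} {K : X → X → ℂ} {f : X → Fin m → ℂ} {A : Matrix (Fin m) (Fin m) ℂ} {g : X → H}
    (hK : ∀ x y, K x y = f x ⬝ᵥ A *ᵥ star (f y) - inner ℂ (g y) (g x)) (p : ι → X) (a : ι → ℂ) :
    ∑ i, ∑ j, K (p i) (p j) * a i * star (a j) =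
      (∑ i, a i • f (p i)) ⬝ᵥ A *ᵥ star (∑ i, a i • f (p i)) -
        inner ℂ (∑ i, a i • g (p i)) (∑ i, a i • g (p i)) := by
  simp only [hK, sub_mul, Finset.sum_sub_distrib, sum_dotProduct, star_sum, mulVec_sum,
    dotProduct_sum, sum_inner, inner_sum, inner_smul_left, inner_smul_right, star_smul,
    mulVec_smul, smul_dotProduct, dotProduct_smul, smul_eq_mul, Finset.mul_sum]
  congr 1
  · rw [Finset.sum_comm]
    refine Finset.sum_congr rfl fun i _ => Finset.sum_congr rfl fun j _ => ?_
    ring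
  · refine Finset.sum_congr rfl fun i _ => Finset.sum_congr rfl fun j _ => ?_
    simp only [starRingEnd_apply]
    ring

open Matrix in
/-- If a kernel of the form `f x ⬝ᵥ A *ᵥ star (f y) - ⟪g y, g x⟫` is nonnegative on families of at
most `k` points and the values of `f` are combinations `f w = ∑ l, c w l • f (z l)` of values at
`card b ≤ k` points, with coefficients that are entire along lines, then the same combinations
express `g`.  Positivity on the points `z`, with `z j` replaced by `w`, bounds the defect
`g w - ∑ l, c w l • g (z l)` by a constant times `c w j`; both are entire along the line from `z j`
to `w`, and the defect vanishes at `z j` while `c w j` does not. -/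
theorem eq_sum_smul_of_nonneg {X : Type*} {H b : Type} [AddCommGroup X] [Module ℂ X]
    [NormedAddCommGroup H] [InnerProductSpace ℂ H]
    [Fintype b] {m k : ℕ} {K : X → X → ℂ} {f : X → Fin m → ℂ} {A : Matrix (Fin m) (Fin m) ℂ}
    {g : X → H} {c : X → b → ℂ} {z : b → X}
    (hK : ∀ x y, K x y = f x ⬝ᵥ A *ᵥ star (f y) - inner ℂ (g y) (g x))
    (hKd : ∀ x v y, Differentiable ℂ fun t : ℂ => K (x + t • v) y)
    (hfd : ∀ x v j, Differentiable ℂ fun t : ℂ => f (x + t • v) j)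
    (hcd : ∀ x v l, Differentiable ℂ fun t : ℂ => c (x + t • v) l)
    (hf : ∀ w, f w = ∑ l, c w l • f (z l)) (hc1 : ∀ j, c (z j) j = 1)
    (hc0 : ∀ j l, l ≠ j → c (z j) l = 0) (hk : 1 ≤ k) (hb : Fintype.card b ≤ k)
    (hpos : ∀ (ι : Type) [Fintype ι], Fintype.card ι ≤ k → ∀ (p : ι → X) (a : ι → ℂ),
      0 ≤ ∑ i, ∑ j, K (p i) (p j) * a i * star (a j)) (w : X) :
    g w = ∑ l, c w l • g (z l) := by
  classical
  set τ : X → H := fun w => g w - ∑ l, c w l • g (z l) with hτ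
  -- The combination of the points `z`, with `z j` replaced by `w`, with weight `1` at `w` and `-c w l`
  -- at `z l`: on `f` it gives `c w j • f (z j)`, on `g` it gives `τ w + c w j • g (z j)`.
  have hupd : ∀ {M : Type _} [AddCommGroup M] [Module ℂ M] (F : X → M) (w : X) (j : b),
      ∑ l, Function.update (fun l => -c w l) j 1 l • F (Function.update z j w l) =
        F w - ∑ l, c w l • F (z l) + c w j • F (z j) := by
    intro M _ _ F w j
    rw [← Finset.add_sum_erase _ _ (Finset.mem_univ j),
      ← Finset.add_sum_erase _ (fun l => c w l • F (z l)) (Finset.mem_univ j)]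
    have : ∑ l ∈ Finset.univ.erase j, Function.update (fun l => -c w l) j 1 l •
        F (Function.update z j w l) = -∑ l ∈ Finset.univ.erase j, c w l • F (z l) := by
      rw [← Finset.sum_neg_distrib]
      refine Finset.sum_congr rfl fun l hl => ?_
      have hl := Finset.ne_of_mem_erase hl
      rw [Function.update_of_ne hl, Function.update_of_ne hl, neg_smul]
    rw [this, Function.update_self, Function.update_self, one_smul]
    abel
  have hbound : ∀ j, ∃ C : ℝ, ∀ w, ‖τ w‖ ≤ C * ‖c w j‖ := by
    intro j
    set q : ℂ := f (z j) ⬝ᵥ A *ᵥ star (f (z j)) with hq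
    refine ⟨√(max q.re 0) + ‖g (z j)‖, fun w => ?_⟩
    have h := hpos b hb (Function.update z j w) (Function.update (fun l => -c w l) j 1)
    rw [sum_kernel_eq hK, hupd, hupd, ← hf, sub_self, zero_add, star_smul, mulVec_smul,
      smul_dotProduct, dotProduct_smul, ← hq, inner_self_eq_norm_sq_to_K] at h
    have h1 : ‖τ w + c w j • g (z j)‖ ^ 2 ≤ ‖c w j‖ ^ 2 * q.re := by
      have h2 := (Complex.nonneg_iff.1 h).1
      have h3 : c w j • star (c w j) • q = ((‖c w j‖ ^ 2 : ℝ) : ℂ) * q := by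
        rw [smul_eq_mul, smul_eq_mul, ← mul_assoc, Complex.star_def, Complex.mul_conj,
          Complex.normSq_eq_norm_sq]
      rw [h3, Complex.sub_re, Complex.re_ofReal_mul] at h2
      have h4 : ((‖τ w + c w j • g (z j)‖ : ℂ) ^ 2).re = ‖τ w + c w j • g (z j)‖ ^ 2 := by
        rw [← Complex.ofReal_pow, Complex.ofReal_re]
      rw [← h4]
      exact sub_nonneg.1 h2
    have h5 : ‖τ w + c w j • g (z j)‖ ≤ ‖c w j‖ * √(max q.re 0) := by
      rw [← sq_le_sq₀ (norm_nonneg _) (by positivity), mul_pow, Real.sq_sqrt (le_max_right _ _)]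
      exact h1.trans (by gcongr; exact le_max_left _ _)
    calc ‖τ w‖ = ‖τ w + c w j • g (z j) - c w j • g (z j)‖ := by rw [add_sub_cancel_right]
      _ ≤ ‖c w j‖ * √(max q.re 0) + ‖c w j‖ * ‖g (z j)‖ := by
        refine (norm_sub_le _ _).trans (add_le_add h5 (norm_smul_le _ _))
      _ = _ := by ring
  have hinner : ∀ x y, inner ℂ (g y) (g x) = f x ⬝ᵥ A *ᵥ star (f y) - K x y := fun x y => by
    rw [hK, sub_sub_cancel]
  suffices hzero : ∀ w u, inner ℂ (g u) (τ w) = 0 by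
    refine sub_eq_zero.1 (inner_self_eq_zero (𝕜 := ℂ).1 ?_)
    change inner ℂ (τ w) (τ w) = 0
    nth_rewrite 1 [hτ]
    simp only [inner_sub_left, sum_inner, inner_smul_left, hzero, mul_zero, Finset.sum_const_zero,
      sub_zero]
  intro w u
  rcases isEmpty_or_nonempty b with hb' | ⟨⟨j⟩⟩
  · -- If there are no points `z`, then `f = 0` and positivity at the single point `w` suffices.
    have h := hpos Unit (by simpa using hk) (fun _ => w) fun _ => 1
    have hfw : f w = 0 := by rw [hf]; simp
    have hgw : g w = 0 := by
      have h2 := (Complex.nonneg_iff.1 h).1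
      simp only [Finset.univ_unique, Finset.sum_singleton, hK, hfw, zero_dotProduct, zero_sub,
        star_one, mul_one, inner_self_eq_norm_sq_to_K] at h2
      have h4 : (-(‖g w‖ : ℂ) ^ 2).re = -‖g w‖ ^ 2 := by
        rw [← Complex.ofReal_pow, ← Complex.ofReal_neg, Complex.ofReal_re]
      have h5 : 0 ≤ -‖g w‖ ^ 2 := h4 ▸ h2
      simpa using h5
    simp [hτ, hgw]
  · obtain ⟨C, hC⟩ := hbound j
    have hline : Differentiable ℂ fun t : ℂ => inner ℂ (g u) (τ (z j + t • (w - z j))) := by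
      simp only [hτ, inner_sub_right, inner_sum, inner_smul_right, hinner, dotProduct]
      exact ((Differentiable.fun_sum fun i _ => (hfd (z j) (w - z j) i).mul_const _).sub
        (hKd (z j) (w - z j) u)).sub
        (Differentiable.fun_sum fun l _ => (hcd (z j) (w - z j) l).mul_const _)
    have := eq_zero_of_norm_le_mul_norm hline (hcd (z j) (w - z j) j) (C := ‖g u‖ * C)
      (fun t => ?_) (t₀ := 0) ?_ ?_ 1
    · simpa using this
    · rw [mul_assoc]
      exact (norm_inner_le_norm _ _).trans (mul_le_mul_of_nonneg_left (hC _) (norm_nonneg _))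
    · have : τ (z j) = 0 := by
        rw [hτ]
        simp only
        rw [Finset.sum_eq_single j (fun l _ hl => by rw [hc0 j l hl, zero_smul]) (by simp), hc1,
          one_smul, sub_self]
      simp [this]
    · simp [hc1]

open Matrix in
/-- A kernel that is a finite-rank kernel `f x ⬝ᵥ A *ᵥ star (f y)` with `f` valued in `ℂᵐ`, `m ≤ k`,
minus a positive semidefinite kernel, is positive semidefinite as soon as it is nonnegative on
families of at most `k` points, provided that everything is entire along lines. -/
theorem sum_nonneg_of_sum_nonneg_card_le {X : Type} [AddCommGroup X] [Module ℂ X]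
    {m k : ℕ} {K : X → X → ℂ} {f : X → Fin m → ℂ} {A : Matrix (Fin m) (Fin m) ℂ}
    (hherm : ∀ x y, f y ⬝ᵥ A *ᵥ star (f x) - K y x = star (f x ⬝ᵥ A *ᵥ star (f y) - K x y))
    (hD : ∀ (s : Finset X) (a : X → ℂ),
      0 ≤ ∑ x ∈ s, ∑ y ∈ s, (f x ⬝ᵥ A *ᵥ star (f y) - K x y) * a x * star (a y))
    (hKd : ∀ x v y, Differentiable ℂ fun t : ℂ => K (x + t • v) y)
    (hfd : ∀ x v j, Differentiable ℂ fun t : ℂ => f (x + t • v) j)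
    (hk : 1 ≤ k) (hm : m ≤ k)
    (hpos : ∀ (ι : Type) [Fintype ι], Fintype.card ι ≤ k → ∀ (p : ι → X) (a : ι → ℂ),
      0 ≤ ∑ i, ∑ j, K (p i) (p j) * a i * star (a j))
    {ι : Type*} [Fintype ι] (p : ι → X) (a : ι → ℂ) :
    0 ≤ ∑ i, ∑ j, K (p i) (p j) * a i * star (a j) := by
  classical
  obtain ⟨H, _, _, g, hg⟩ := exists_featureMap hherm hD
  have hK : ∀ x y, K x y = f x ⬝ᵥ A *ᵥ star (f y) - inner ℂ (g y) (g x) := fun x y => by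
    rw [hg, sub_sub_cancel]
  -- Points `z` at which the values of `f` form a basis of the span of all its values.
  obtain ⟨b, hbs, hspan, hli⟩ := exists_linearIndependent ℂ (Set.range f)
  have hfin : Fintype b := hli.setFinite.fintype
  have hcard : Fintype.card b ≤ k := by
    have := hli.fintype_card_le_finrank
    rw [Module.finrank_fin_fun] at this
    exact this.trans hm
  choose z hz using fun l : b => hbs l.2
  -- Coordinates on the span, extended linearly so that they can be composed with `f`.
  obtain ⟨φ, hφ⟩ := LinearMap.exists_extend hli.repr
  have hφl : ∀ l : b, φ l = Finsupp.single l 1 := fun l => by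
    have hl : (l : Fin m → ℂ) ∈ Submodule.span ℂ (Set.range ((↑) : b → Fin m → ℂ)) :=
      Submodule.subset_span ⟨l, rfl⟩
    rw [← hli.repr_eq_single l ⟨l, hl⟩ rfl, ← hφ]
    rfl
  set c : X → b → ℂ := fun w l => φ (f w) l with hc
  have hf : ∀ w, f w = ∑ l, c w l • f (z l) := fun w => by
    have hw : f w ∈ Submodule.span ℂ (Set.range ((↑) : b → Fin m → ℂ)) := by
      rw [Subtype.range_coe_subtype, Set.ofPred_mem_eq, hspan]
      exact Submodule.subset_span ⟨w, rfl⟩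
    have h1 := hli.linearCombination_repr ⟨f w, hw⟩
    have h2 : hli.repr ⟨f w, hw⟩ = φ (f w) := by rw [← hφ]; rfl
    rw [h2, Finsupp.linearCombination_apply, Finsupp.sum_fintype _ _ (by simp)] at h1
    simp only [hz]
    exact h1.symm
  have hcd : ∀ x v l, Differentiable ℂ fun t : ℂ => c (x + t • v) l := by
    intro x v l
    have h := ((Finsupp.lapply l : (b →₀ ℂ) →ₗ[ℂ] ℂ) ∘ₗ φ).toContinuousLinearMap.differentiable.comp
      (differentiable_pi.2 (hfd x v))
    exact h
  have hgc := eq_sum_smul_of_nonneg hK hKd hfd hcd hf (fun j => by simp [hc, hz, hφl])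
    (fun j l hl => by simp [hc, hz, hφl, hl.symm]) hk hcard hpos
  have hcomb : ∀ {M : Type} [AddCommGroup M] [Module ℂ M] (F : X → M),
      (∀ w, F w = ∑ l, c w l • F (z l)) →
      ∑ i, a i • F (p i) = ∑ l, (∑ i, a i * c (p i) l) • F (z l) := by
    intro M _ _ F hF
    conv_lhs => enter [2, i]; rw [hF]
    simp only [Finset.smul_sum, Finset.sum_smul, smul_smul]
    exact Finset.sum_comm
  rw [sum_kernel_eq hK, hcomb f hf, hcomb g hgc, ← sum_kernel_eq hK]
  exact hpos b hcard z _

/-! ### Rapidly decreasing sequences and their power series -/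

/-- The square-summable families on multi-indices that decay faster than `r ^ (-|a|)` for every
`r > 0`, that is, the coefficient families of entire functions. -/
def rapidlyDecreasing (n : ℕ) : Submodule ℂ (lp (fun _ : Fin n → ℕ => ℂ) 2) where
  carrier := {v | ∀ r : ℝ, 0 < r → ∃ M : ℝ, ∀ a, ‖v a‖ ≤ M * r⁻¹ ^ ∑ i, a i}
  zero_mem' := fun r _ => ⟨0, fun a => by simp⟩
  add_mem' := fun {v w} hv hw r hr => by
    obtain ⟨M, hM⟩ := hv r hr
    obtain ⟨N, hN⟩ := hw r hr
    exact ⟨M + N, fun a => (norm_add_le _ _).trans ((add_le_add (hM a) (hN a)).trans_eq (by ring))⟩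
  smul_mem' := fun t v hv r hr => by
    obtain ⟨M, hM⟩ := hv r hr
    refine ⟨‖t‖ * M, fun a => ?_⟩
    rw [lp.coeFn_smul, Pi.smul_apply, norm_smul, mul_assoc]
    exact mul_le_mul_of_nonneg_left (hM a) (norm_nonneg _)

variable {n : ℕ}

theorem matrixEigenspace_taylorMatrix_le {R : (Fin n → ℂ) × (Fin n → ℂ) → ℂ}
    (hR : Differentiable ℂ R) {μ : ℂ} (hμ : μ ≠ 0) :
    matrixEigenspace (taylorMatrix R) μ ≤ rapidlyDecreasing n := by
  intro v hv r hr
  obtain ⟨ρ, hρ⟩ : ∃ ρ, ρ = max r 2 := ⟨_, rfl⟩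
  have hρ2 : 2 ≤ ρ := hρ ▸ le_max_right _ _
  obtain ⟨M, hM0, hM⟩ := exists_norm_taylorMatrix_le hR (show 0 < ρ by linarith)
  have hs : Summable fun b : Fin n → ℕ => ρ⁻¹ ^ ∑ i, b i :=
    summable_pow_sum (by positivity) (inv_lt_one_of_one_lt₀ (by linarith))
  refine ⟨‖μ‖⁻¹ * (M * ((∑' b : Fin n → ℕ, ρ⁻¹ ^ ∑ i, b i) * ‖v‖)), fun a => ?_⟩
  have h1 : ‖μ * v a‖ ≤ M * (ρ⁻¹ ^ ∑ i, a i) * ((∑' b : Fin n → ℕ, ρ⁻¹ ^ ∑ i, b i) * ‖v‖) := by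
    rw [← (hv a).tsum_eq]
    refine tsum_of_norm_bounded ((hs.hasSum.mul_right ‖v‖).mul_left _) fun b => ?_
    rw [norm_mul, ← mul_assoc]
    exact mul_le_mul (hM a b) (lp.norm_apply_le_norm (by norm_num) v b) (norm_nonneg _)
      (by positivity)
  rw [norm_mul, ← le_inv_mul_iff₀ (norm_pos_iff.2 hμ)] at h1
  have htsum : 0 ≤ ∑' b : Fin n → ℕ, ρ⁻¹ ^ ∑ i, b i := tsum_nonneg fun b => by positivity
  have hle : ρ⁻¹ ^ (∑ i, a i) ≤ r⁻¹ ^ ∑ i, a i := by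
    gcongr
    exact hρ ▸ le_max_left _ _
  calc ‖v a‖ ≤ _ := h1
    _ = ‖μ‖⁻¹ * (M * ((∑' b : Fin n → ℕ, ρ⁻¹ ^ ∑ i, b i) * ‖v‖)) * (ρ⁻¹ ^ ∑ i, a i) := by ring
    _ ≤ _ := by gcongr

/-- The terms of the power series of a rapidly decreasing family are dominated, on every bounded
set, by a summable family. -/
theorem exists_summable_bound {v : lp (fun _ : Fin n → ℕ => ℂ) 2} (hv : v ∈ rapidlyDecreasing n)
    {ρ : ℝ} (hρ : 0 ≤ ρ) : ∃ u : (Fin n → ℕ) → ℝ, Summable u ∧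
      ∀ t : Fin n → ℂ, ‖t‖ ≤ ρ → ∀ a, ‖v a * ∏ i, t i ^ a i‖ ≤ u a := by
  have hr : 0 < ρ + 1 := by linarith
  obtain ⟨M, hM⟩ := hv (ρ + 1) hr
  refine ⟨fun a => M * ((ρ + 1)⁻¹ * ρ) ^ ∑ i, a i, (summable_pow_sum (by positivity)
    (by rw [inv_mul_lt_one₀ hr]; linarith)).mul_left M, fun t ht a => ?_⟩
  beta_reduce
  rw [norm_mul, mul_pow, ← mul_assoc]
  exact mul_le_mul (hM a) ((norm_monomial_le t a).trans (by gcongr)) (norm_nonneg _)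
    ((norm_nonneg _).trans (hM a))

theorem hasSum_powerSeries {v : lp (fun _ : Fin n → ℕ => ℂ) 2} (hv : v ∈ rapidlyDecreasing n)
    (t : Fin n → ℂ) : HasSum (fun a => v a * ∏ i, t i ^ a i) (∑' a, v a * ∏ i, t i ^ a i) := by
  obtain ⟨u, hu, hle⟩ := exists_summable_bound hv (norm_nonneg t)
  exact (Summable.of_norm_bounded hu (hle t le_rfl)).hasSum

theorem differentiable_powerSeries_line {v : lp (fun _ : Fin n → ℕ => ℂ) 2}
    (hv : v ∈ rapidlyDecreasing n) (x w : Fin n → ℂ) :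
    Differentiable ℂ fun s : ℂ => ∑' a, v a * ∏ i, (x + s • w) i ^ a i := by
  intro s₀
  obtain ⟨u, hu, hle⟩ := exists_summable_bound hv
    (show 0 ≤ ‖x‖ + (‖s₀‖ + 1) * ‖w‖ by positivity)
  refine (Complex.differentiableOn_tsum_of_summable_norm (U := Metric.ball 0 (‖s₀‖ + 1)) hu
    (fun a => ?_) Metric.isOpen_ball fun a s hs => hle _ ?_ a).differentiableAt
    (Metric.isOpen_ball.mem_nhds (by simp))
  · have : Differentiable ℂ fun s : ℂ => v a * ∏ i, (x i + s * w i) ^ a i := by fun_prop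
    exact this.differentiableOn
  · refine (norm_add_le _ _).trans ?_
    rw [norm_smul]
    have := (mem_ball_zero_iff.1 hs).le
    gcongr

/-! ### Truncations of the point evaluations -/

/-- The truncation to the finite set `s` of the family `conj (z ^ a)` of conjugate monomials, which
represents evaluation at `z`. The full family need not be square-summable. -/
noncomputable def monomialVec (s : Finset (Fin n → ℕ)) (z : Fin n → ℂ) :
    lp (fun _ : Fin n → ℕ => ℂ) 2 :=
  ∑ a ∈ s, star (∏ i, z i ^ a i) • unitVec a

theorem tendsto_inner_monomialVec {v : lp (fun _ : Fin n → ℕ => ℂ) 2}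
    (hv : v ∈ rapidlyDecreasing n) (z : Fin n → ℂ) :
    Filter.Tendsto (fun s => inner ℂ v (monomialVec s z)) Filter.atTop
      (nhds (star (∑' a, v a * ∏ i, z i ^ a i))) := by
  have h := (hasSum_powerSeries hv z).star
  refine Filter.Tendsto.congr (fun s => ?_) h
  rw [monomialVec, inner_sum]
  refine Finset.sum_congr rfl fun a _ => ?_
  have : inner ℂ v (unitVec a) = star (v a) := by
    rw [← inner_conj_symm, inner_unitVec_left]; rfl
  beta_reduce
  rw [inner_smul_right, this, star_mul]

theorem inner_matrixOp_monomialVec {c : Matrix (Fin n → ℕ) (Fin n → ℕ) ℂ}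
    (hc : Summable fun p : (Fin n → ℕ) × (Fin n → ℕ) => ‖c p.1 p.2‖) (s : Finset (Fin n → ℕ))
    (z w : Fin n → ℂ) :
    inner ℂ (monomialVec s z) (matrixOp c (monomialVec s w)) =
      ∑ p ∈ s ×ˢ s, c p.1 p.2 * ((∏ i, z i ^ p.1 i) * ∏ i, star w i ^ p.2 i) := by
  have hunit : ∀ a b, inner ℂ (unitVec a) (matrixOp c (unitVec b)) = c a b := fun a b => by
    rw [inner_unitVec_left]
    refine (hasSum_matrixOp_apply hc (unitVec b) a).unique ?_
    have := hasSum_single (f := fun b' => c a b' * unitVec b b') b fun b' hb' => by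
      rw [unitVec_apply_of_ne hb', mul_zero]
    rwa [unitVec_apply_self, mul_one] at this
  simp only [monomialVec, map_sum, map_smul, sum_inner, inner_sum, inner_smul_left,
    inner_smul_right, hunit, Finset.sum_product, Finset.mul_sum]
  rw [Finset.sum_comm]
  refine Finset.sum_congr rfl fun a _ => Finset.sum_congr rfl fun b _ => ?_
  simp only [starRingEnd_apply, star_star, star_prod, star_pow, Pi.star_apply]
  ring

theorem tendsto_inner_matrixOp_monomialVec {R : (Fin n → ℂ) × (Fin n → ℂ) → ℂ}
    (hR : Differentiable ℂ R) (z w : Fin n → ℂ) :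
    Filter.Tendsto (fun s => inner ℂ (monomialVec s z)
      (matrixOp (taylorMatrix R) (monomialVec s w))) Filter.atTop (nhds (R (z, star w))) := by
  simp only [inner_matrixOp_monomialVec (summable_norm_taylorMatrix hR)]
  exact (hasSum_taylorMatrix hR z (star w)).comp
    (Filter.tendsto_finsetProd_atTop.comp Filter.tendsto_atTop_diagonal)

/-! ### Kernels with finitely many positive eigenvalues -/

open Matrix in
/-- A Hermitian symmetric function with at most `k` positive eigenvalues is the difference of a
kernel of rank at most `k` with holomorphic components, coming from the compression of the Taylor
matrix to the sum of the eigenspaces for positive eigenvalues, and of a positive semidefinite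
kernel. -/
theorem exists_finiteRank_sub_posSemidef {k : ℕ} {R : (Fin n → ℂ) × (Fin n → ℂ) → ℂ}
    (hR : R ∈ atMostPosEigenvalues n k) :
    ∃ m ≤ k, ∃ (f : (Fin n → ℂ) → Fin m → ℂ) (A : Matrix (Fin m) (Fin m) ℂ),
      (∀ x v j, Differentiable ℂ fun t : ℂ => f (x + t • v) j) ∧
      (∀ x y, f y ⬝ᵥ A *ᵥ star (f x) - R (y, star x) =
        star (f x ⬝ᵥ A *ᵥ star (f y) - R (x, star y))) ∧
      ∀ (s : Finset (Fin n → ℂ)) (a : (Fin n → ℂ) → ℂ), 0 ≤ ∑ x ∈ s, ∑ y ∈ s,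
        (f x ⬝ᵥ A *ᵥ star (f y) - R (x, star y)) * a x * star (a y) := by
  obtain ⟨hRs, hRk⟩ := hR
  have hc := summable_norm_taylorMatrix hRs.holomorphic
  set T := matrixOp (taylorMatrix R) with hT
  have hTs : (T : Module.End ℂ (lp (fun _ : Fin n → ℕ => ℂ) 2)).IsSymmetric :=
    isSymmetric_matrixOp hc fun a b => taylorMatrix_star hRs a b
  have hTc : IsCompactOperator T := isCompactOperator_matrixOp hc
  set W : Submodule ℂ (lp (fun _ : Fin n → ℕ => ℂ) 2) :=
    ⨆ (μ : ℝ) (_ : 0 < μ), matrixEigenspace (taylorMatrix R) (μ : ℂ) with hW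
  have hrank : Module.rank ℂ W ≤ k := Cardinal.toENat_le_natCast.1 hRk
  have hfd : FiniteDimensional ℂ W :=
    Module.rank_lt_aleph0_iff.1 (hrank.trans_lt (Cardinal.natCast_lt_aleph0))
  have hWdec : W ≤ rapidlyDecreasing n := iSup₂_le fun μ hμ =>
    matrixEigenspace_taylorMatrix_le hRs.holomorphic (Complex.ofReal_ne_zero.2 hμ.ne')
  have hWT : W = ⨆ (μ : ℝ) (_ : 0 < μ),
      Module.End.eigenspace (T : Module.End ℂ (lp (fun _ : Fin n → ℕ => ℂ) 2)) (μ : ℂ) := by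
    simp only [hW, matrixEigenspace_eq_eigenspace hc, hT]
  have hTW : ∀ x ∈ W, T x ∈ W := by
    have : W ≤ W.comap (T : Module.End ℂ (lp (fun _ : Fin n → ℕ => ℂ) 2)) := by
      nth_rewrite 1 [hWT]
      refine iSup₂_le fun μ hμ x hx => ?_
      rw [Submodule.mem_comap, Module.End.mem_eigenspace_iff.1 hx, hWT]
      exact Submodule.smul_mem _ _ (Submodule.mem_iSup_of_mem μ (Submodule.mem_iSup_of_mem hμ hx))
    exact this
  set v := stdOrthonormalBasis ℂ W with hv
  set P := W.starProjection with hP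
  have hPsum : ∀ x, P x = ∑ j, inner ℂ (v j : lp (fun _ : Fin n → ℕ => ℂ) 2) x •
      (v j : lp (fun _ : Fin n → ℕ => ℂ) 2) := fun x => by
    rw [hP, v.starProjection_eq_sum_rankOne]
    simp
  have hvdec : ∀ j, (v j : lp (fun _ : Fin n → ℕ => ℂ) 2) ∈ rapidlyDecreasing n :=
    fun j => hWdec (v j).2
  set f : (Fin n → ℂ) → Fin (Module.finrank ℂ W) → ℂ := fun z j =>
    ∑' a, (v j : lp (fun _ : Fin n → ℕ => ℂ) 2) a * ∏ i, z i ^ a i with hf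
  set A : Matrix (Fin (Module.finrank ℂ W)) (Fin (Module.finrank ℂ W)) ℂ := fun i j =>
    inner ℂ (v i : lp (fun _ : Fin n → ℕ => ℂ) 2) (T (v j)) with hA
  set Q : lp (fun _ : Fin n → ℕ => ℂ) 2 → lp (fun _ : Fin n → ℕ => ℂ) 2 := fun x => x - P x with hQ
  have hPW : ∀ x, P x ∈ W := fun x => W.starProjection_apply_mem x
  have hQW : ∀ x, Q x ∈ Wᗮ := fun x => W.sub_starProjection_mem_orthogonal x
  -- `W` reduces `T`, so the form of `T` splits along `W` and its orthogonal complement.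
  have hsplit : ∀ x y, inner ℂ (P x) (T (P y)) - inner ℂ x (T y) = -inner ℂ (Q x) (T (Q y)) := by
    intro x y
    have h1 : inner ℂ (P x) (T (Q y)) = 0 := by
      have := hTs (P x) (Q y)
      exact this.symm.trans ((hQW y) _ (hTW _ (hPW x)))
    have h2 : inner ℂ (Q x) (T (P y)) = 0 := by
      rw [← inner_conj_symm, (hQW x) _ (hTW _ (hPW y)), map_zero]
    have hx : x = P x + Q x := by simp [hQ]
    have hy : y = P y + Q y := by simp [hQ]
    have h3 : inner ℂ x (T y) = inner ℂ (P x + Q x) (T (P y + Q y)) := by rw [← hx, ← hy]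
    rw [h3, map_add, inner_add_left, inner_add_right, inner_add_right, h1, h2]
    ring
  have htend : ∀ x y, Filter.Tendsto
      (fun s => -inner ℂ (Q (monomialVec s x)) (T (Q (monomialVec s y)))) Filter.atTop
      (nhds (f x ⬝ᵥ A *ᵥ star (f y) - R (x, star y))) := by
    intro x y
    simp only [← hsplit]
    refine Filter.Tendsto.sub ?_ (tendsto_inner_matrixOp_monomialVec hRs.holomorphic x y)
    simp only [hPsum, map_sum, map_smul, sum_inner, inner_sum, inner_smul_left, inner_smul_right]
    simp only [dotProduct, mulVec, Finset.mul_sum]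
    rw [Finset.sum_comm]
    refine tendsto_finsetSum _ fun j _ => tendsto_finsetSum _ fun i _ => ?_
    have h1 := (tendsto_inner_monomialVec (hvdec i) x).star
    have h2 := tendsto_inner_monomialVec (hvdec j) y
    rw [star_star] at h1
    refine ((h1.mul (h2.const_mul (A i j))).congr fun s => ?_)
    rw [starRingEnd_apply]
    ring
  refine ⟨Module.finrank ℂ W, ?_, f, A, ?_, ?_, ?_⟩
  · rw [← Module.finrank_eq_rank] at hrank
    exact_mod_cast hrank
  · exact fun x w j => differentiable_powerSeries_line (hvdec j) x w
  · intro x y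
    refine tendsto_nhds_unique (htend y x) (((htend x y).star).congr fun s => ?_)
    rw [star_neg]
    congr 1
    have := hTs (Q (monomialVec s y)) (Q (monomialVec s x))
    exact (inner_conj_symm _ _).trans this
  · intro s a
    refine ge_of_tendsto' (tendsto_finsetSum _ fun x _ => tendsto_finsetSum _ fun y _ =>
      ((htend x y).mul_const (a x)).mul_const (star (a y))) fun t => ?_
    set X := ∑ x ∈ s, star (a x) • Q (monomialVec t x) with hX
    have hXW : X ∈ Wᗮ := Submodule.sum_mem _ fun x _ => Submodule.smul_mem _ _ (hQW _)
    have hXneg := re_inner_nonpos_of_mem_orthogonal hTc hTs (hWT ▸ hXW)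
    have hXim : (inner ℂ X (T X)).im = 0 := by
      have : starRingEnd ℂ (inner ℂ X (T X)) = inner ℂ X (T X) :=
        (inner_conj_symm _ _).trans (hTs X X)
      exact Complex.conj_eq_iff_im.1 this
    have hsum : ∑ x ∈ s, ∑ y ∈ s, -inner ℂ (Q (monomialVec t x)) (T (Q (monomialVec t y))) * a x *
        star (a y) = -inner ℂ X (T X) := by
      simp only [hX, map_sum, map_smul, sum_inner, inner_sum, inner_smul_left, inner_smul_right,
        ← Finset.sum_neg_distrib, Finset.mul_sum]
      rw [Finset.sum_comm]
      refine Finset.sum_congr rfl fun x _ => Finset.sum_congr rfl fun y _ => ?_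
      rw [starRingEnd_apply, star_star]
      ring
    rw [hsum, Complex.nonneg_iff]
    simp [hXneg, hXim]

/-- Positivity on families of `k` points implies positivity on smaller families, by padding with
zero weights. -/
theorem sum_nonneg_of_mem_posClass {k : ℕ} {R : (Fin n → ℂ) × (Fin n → ℂ) → ℂ}
    (hR : R ∈ posClass n k) {ι : Type*} [Fintype ι] (hι : Fintype.card ι ≤ k)
    (p : ι → Fin n → ℂ) (a : ι → ℂ) : 0 ≤ ∑ i, ∑ j, R (p i, star (p j)) * a i * star (a j) := by
  obtain ⟨e⟩ : Nonempty (ι ↪ Fin k) := Function.Embedding.nonempty_of_card_le (by simpa using hι)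
  have h := hR.2 (Function.extend e p 0) (Function.extend e a 0)
  have hout : ∀ i ∉ Set.range e, Function.extend e a 0 i = 0 := fun i hi =>
    Function.extend_apply' _ _ _ hi
  rw [← Finset.sum_of_injOn e (s := Finset.univ) e.injective.injOn (by simp)
    (fun i _ hi => Finset.sum_eq_zero fun j _ => by
      rw [hout i (by simpa using hi), mul_zero, zero_mul]) fun i _ => rfl] at h
  refine h.trans_eq (Finset.sum_congr rfl fun i _ => ?_)
  rw [← Finset.sum_of_injOn e (s := Finset.univ) e.injective.injOn (by simp)
    (fun j _ hj => by rw [hout j (by simpa using hj), star_zero, mul_zero]) fun i _ => rfl]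
  simp only [e.injective.extend_apply]

theorem atMostPosEigenvalues_inter_posClass {k : ℕ} (hk : 1 ≤ k) :
    atMostPosEigenvalues n k ∩ posClass n k = atMostPosEigenvalues n k ∩ posClassInf n := by
  refine Set.Subset.antisymm (fun R hR => ⟨hR.1, ?_⟩) fun R hR =>
    ⟨hR.1, Set.mem_iInter₂.1 hR.2 k hk⟩
  obtain ⟨m, hm, f, A, hfd, hherm, hD⟩ := exists_finiteRank_sub_posSemidef hR.1
  refine Set.mem_iInter₂.2 fun N _ => ⟨hR.1.1, fun z a => ?_⟩
  refine sum_nonneg_of_sum_nonneg_card_le (K := fun x y => R (x, star y)) hherm hD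
    (fun x v y => ?_) hfd hk hm (fun ι _ hι p a => sum_nonneg_of_mem_posClass hR.2 hι p a) z a
  exact hR.1.1.holomorphic.comp (by fun_prop)

end HermitianSymmetric

theorem corollary1 (n k : ℕ) (hk : 1 ≤ k) :
    HermitianSymmetric.atMostPosEigenvalues n k ∩ HermitianSymmetric.posClass n k =
        HermitianSymmetric.atMostPosEigenvalues n k ∩ HermitianSymmetric.posClassInf n ∧
      HermitianSymmetric.stabilityIndex (HermitianSymmetric.atMostPosEigenvalues n k) ≤ (k : ℕ∞) ∧
      HermitianSymmetric.IsStable (HermitianSymmetric.atMostPosEigenvalues n k) := by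
  have h := HermitianSymmetric.atMostPosEigenvalues_inter_posClass (n := n) hk
  have hle : HermitianSymmetric.stabilityIndex (HermitianSymmetric.atMostPosEigenvalues n k) ≤
      (k : ℕ∞) := sInf_le ⟨k, hk, rfl, h.symm⟩
  exact ⟨h, hle, (hle.trans_lt (ENat.natCast_lt_top k)).ne⟩
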